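/- Let $M$ be a smooth ($C^\infty$) finite-dimensional Hausdorff manifold and $\mathbf{T}M=TM\oplus T^*M$ its big tangent bundle, with the neutral metric $g((X,\alpha),(Y,\mu))=\alpha(Y)+\mu(X)$, the Courant bracket $$[(X,\alpha),(Y,\mu)]=\big([X,Y],\,L_X\mu-L_Y\alpha+\tfrac12 d(\alpha(Y)-\mu(X))\big)$$ and the projection $\mathrm{pr}_{TM}(X,\alpha)=X$. Let $G$ be a generalized Riemannian metric on $M$, i.e. $G(\mathcal X,\mathcal Y)=g(\phi\mathcal X,\mathcal Y)$ is positive definite, where $\phi\in End(\mathbf{T}M)$ satisfies $\phi^2=Id$ and $g(\phi\mathcal X,\phi\mathcal Y)=g(\mathcal X,\mathcal Y)$. Let $E\subseteq\mathbf{T}M$ be a smooth subbundle of constant rank that is $g$-isotropic ($g|_E=0$). A generalized, metric, 2-nilpotent structure with image $E$ is a $\tau\in End(\mathbf{T}M)$ of constant rank with $\tau^2=0$, $g(\mathcal X,\tau\mathcal Y)+g(\tau\mathcal X,\mathcal Y)=0$, $im\,\tau=E$ and $G(\tau\mathcal X,\tau\mathcal Y)=G(\mathcal X,\mathcal Y)$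 for all $\mathcal X,\mathcal Y\in\phi(E)$. It is integrable if $$\mathcal N_\tau(\mathcal X,\mathcal Y)=[\tau\mathcal X,\tau\mathcal Y]-\tau[\mathcal X,\tau\mathcal Y]-\tau[\tau\mathcal X,\mathcal Y]+\tau^2[\mathcal X,\mathcal Y]=0\qquad\forall\,\mathcal X,\mathcal Y\in\Gamma\mathbf{T}M.$$ A complex structure on $E$ compatible with $G|_E$ is a $\lambda\in End(E)$ with $\lambda^2=-Id$ and $G(\lambda e_1,\lambda e_2)=G(e_1,e_2)$ for all $e_1,e_2\in E$. Then $\tau\mapsto\lambda=\tau\circ\phi|_E$ is a bijection from the set of generalized, metric, 2-nilpotent structures $\tau$ with $im\,\tau=E$ onto the set of complex structures $\lambda$ on $E$ compatible with $G|_E$. Moreover, such a $\tau$ is integrable if and only if $E$ is closed under Courant brackets and $(G|_E,\lambda)$ is an almost Kähler structure on the Lie algebroid $E$ (with the Courant bracket and the anchor $\mathrm{pr}_{TM}|_E$); that is, the fundamental form $\omega\in\Gamma\wedge^2E^*$, $\omega(e_1,e_2)=G(\lambda e_1,e_2)$, satisfies $d_E\omega=0$, where $$\begin{aligned}d_E\omega(e_1,e_2,e_3)={}&\mathrm{pr}_{TM}e_1(\omega(e_2,e_3))-\mathrm{pr}_{TM}e_2(\omega(e_1,e_3))+\mathrm{pr}_{TM}e_3(\omega(e_1,e_2))\\&-\omega([e_1,e_2],e_3)+\omega([e_1,e_3],e_2)-\omega([e_2,e_3],e_1),\qquad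 e_1,e_2,e_3\in\Gamma E.\end{aligned}$$ -/

import Mathlib

open scoped Manifold ContDiff
open Bundle VectorField

noncomputable section

namespace GenGeom

section BigTangentBundle

variable (V : Type*) [NormedAddCommGroup V] [NormedSpace ℝ V]
  {M : Type*} [TopologicalSpace M] [ChartedSpace V M]

/-- The cotangent space `T*ₓM`. -/
abbrev Cotangent (x : M) : Type _ := TangentSpace 𝓘(ℝ, V) x →L[ℝ] ℝ

/-- The fibre at `x` of the big tangent bundle `𝐓M = TM ⊕ T*M`; its elements are the pairs
`(X, α)`. -/
abbrev BigTangent (x : M) : Type _ := TangentSpace 𝓘(ℝ, V) x × Cotangent V x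

/-- The neutral metric `g((X, α), (Y, μ)) = α(Y) + μ(X)` of the big tangent bundle. -/
def neutral (x : M) : BigTangent V x →ₗ[ℝ] BigTangent V x →ₗ[ℝ] ℝ :=
  LinearMap.mk₂ ℝ (fun a b : BigTangent V x => a.2 b.1 + b.2 a.1)
    (fun a a' b => by
      simp only [Prod.fst_add, Prod.snd_add, map_add, add_apply]; ring)
    (fun c a b => by
      simp only [Prod.smul_fst, Prod.smul_snd, map_smul, smul_apply,
        smul_eq_mul]; ring)
    (fun a b b' => by
      simp only [Prod.fst_add, Prod.snd_add, map_add, add_apply]; ring)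
    (fun c a b => by
      simp only [Prod.smul_fst, Prod.smul_snd, map_smul, smul_apply,
        smul_eq_mul]; ring)

/-- The Lie derivative `L_X μ` of a `1`-form along a vector field. At `x` it is computed in the
chart around `x`: there `(L_X μ)(v) = (Dμ · X)(v) + μ(DX · v)`, and the resulting covector is
pulled back to `TₓM` by the differential of the chart. -/
def lieDerivForm (X : ∀ x : M, TangentSpace 𝓘(ℝ, V) x) (μ : ∀ x : M, Cotangent V x) (x : M) :
    Cotangent V x :=
  let ψ : V → M := (extChartAt 𝓘(ℝ, V) x).symm
  let y : V := extChartAt 𝓘(ℝ, V) x x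
  let Xc : V → V := fun z => mpullback 𝓘(ℝ, V) 𝓘(ℝ, V) ψ X z
  let μc : V → V →L[ℝ] ℝ := fun z => (μ (ψ z)).comp (mfderiv 𝓘(ℝ, V) 𝓘(ℝ, V) ψ z)
  (fderiv ℝ μc y (Xc y) + (μc y).comp (fderiv ℝ Xc y)).comp
    (mfderiv 𝓘(ℝ, V) 𝓘(ℝ, V) (extChartAt 𝓘(ℝ, V) x) x)

/-- The Courant bracket
`[(X, α), (Y, μ)] = ([X, Y], L_X μ - L_Y α + ½ d(α(Y) - μ(X)))`. -/
def courant (a b : ∀ x : M, BigTangent V x) (x : M) : BigTangent V x :=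
  (mlieBracket 𝓘(ℝ, V) (fun y => (a y).1) (fun y => (b y).1) x,
    lieDerivForm V (fun y => (a y).1) (fun y => (b y).2) x
      - lieDerivForm V (fun y => (b y).1) (fun y => (a y).2) x
      + (1 / 2 : ℝ) • mvfderiv 𝓘(ℝ, V) (fun y => (a y).2 (b y).1 - (b y).2 (a y).1) x)

/-- The Courant-Nijenhuis torsion
`N_τ(X, Y) = [τX, τY] - τ[X, τY] - τ[τX, Y] + τ²[X, Y]`. -/
def nijenhuis (τ : ∀ x : M, BigTangent V x →ₗ[ℝ] BigTangent V x)
    (a b : ∀ x : M, BigTangent V x) (x : M) : BigTangent V x :=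
  courant V (fun y => τ y (a y)) (fun y => τ y (b y)) x
    - τ x (courant V a (fun y => τ y (b y)) x)
    - τ x (courant V (fun y => τ y (a y)) b x)
    + τ x (τ x (courant V a b x))

end BigTangentBundle

section Structures

variable (V : Type*) [NormedAddCommGroup V] [NormedSpace ℝ V]
  {M : Type*} [TopologicalSpace M] [ChartedSpace V M] [IsManifold 𝓘(ℝ, V) ∞ M]

/-- A section of the big tangent bundle is smooth on `U` if its vector field and its `1`-form
are. -/
def SmoothSectionOn (a : ∀ x : M, BigTangent V x) (U : Set M) : Prop :=
  ContMDiffOn 𝓘(ℝ, V) (𝓘(ℝ, V).prod 𝓘(ℝ, V)) ∞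
      (fun x => TotalSpace.mk' V (E := fun x : M => TangentSpace 𝓘(ℝ, V) x) x (a x).1) U ∧
    ContMDiffOn 𝓘(ℝ, V) (𝓘(ℝ, V).prod 𝓘(ℝ, V →L[ℝ] ℝ)) ∞
      (fun x => TotalSpace.mk' (V →L[ℝ] ℝ) (E := fun x : M => TangentSpace 𝓘(ℝ, V) x →L[ℝ] ℝ)
        x (a x).2) U

/-- Elements of `Γ𝐓M`. -/
def SmoothSection (a : ∀ x : M, BigTangent V x) : Prop := SmoothSectionOn V a Set.univ

/-- A field of fibrewise endomorphisms is an element of `End(𝐓M)`, i.e. it is smooth, if it maps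
smooth sections to smooth sections. -/
def SmoothEndo (τ : ∀ x : M, BigTangent V x →ₗ[ℝ] BigTangent V x) : Prop :=
  ∀ a : ∀ x : M, BigTangent V x, SmoothSection V a → SmoothSection V (fun x => τ x (a x))

variable (M)

/-- A generalized Riemannian metric `G` on `M`, given by the endomorphism `φ` of `𝐓M` with
`φ² = Id`, `g(φa, φb) = g(a, b)` and such that `G(a, b) = g(φa, b)` is positive definite. -/
structure GenRiemannianMetric where
  φ : ∀ x : M, BigTangent V x →ₗ[ℝ] BigTangent V x
  smooth : SmoothEndo V φ
  φ_sq : ∀ (x : M) (a : BigTangent V x), φ x (φ x a) = a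
  φ_isometry : ∀ (x : M) (a b : BigTangent V x),
    neutral V x (φ x a) (φ x b) = neutral V x a b
  pos : ∀ (x : M) (a : BigTangent V x), a ≠ 0 → 0 < neutral V x (φ x a) a

/-- A smooth subbundle of `𝐓M`: a family of subspaces of the fibres which, around each point, is
spanned by a smooth local frame with a fixed number of elements. -/
structure Subbundle where
  fiber : ∀ x : M, Submodule ℝ (BigTangent V x)
  rank : ℕ
  exists_frame : ∀ x₀ : M, ∃ U : Set M, IsOpen U ∧ x₀ ∈ U ∧
    ∃ s : Fin rank → ∀ x : M, BigTangent V x,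
      (∀ i, SmoothSectionOn V (s i) U) ∧
      ∀ x ∈ U, LinearIndependent ℝ (fun i => s i x) ∧
        Submodule.span ℝ (Set.range fun i => s i x) = fiber x

variable {M}

/-- The positive definite metric `G(a, b) = g(φa, b)`. -/
def GenRiemannianMetric.form (G : GenRiemannianMetric V M) (x : M) :
    BigTangent V x →ₗ[ℝ] BigTangent V x →ₗ[ℝ] ℝ :=
  (neutral V x).comp (G.φ x)

/-- `E` is `g`-isotropic (big-isotropic). -/
def Subbundle.IsIsotropic (E : Subbundle V M) : Prop :=
  ∀ x : M, ∀ a ∈ E.fiber x, ∀ b ∈ E.fiber x, neutral V x a b = 0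

/-- Elements of `ΓE`. -/
def Subbundle.IsSection (E : Subbundle V M) (e : ∀ x : M, E.fiber x) : Prop :=
  SmoothSection V (fun x => (e x : BigTangent V x))

/-- `E` is closed under Courant brackets. -/
def Subbundle.CourantClosed (E : Subbundle V M) : Prop :=
  ∀ e₁ e₂ : ∀ x : M, E.fiber x, E.IsSection V e₁ → E.IsSection V e₂ →
    ∀ x : M, courant V (fun y => (e₁ y : BigTangent V y)) (fun y => (e₂ y : BigTangent V y)) x
      ∈ E.fiber x

/-- Generalized 2-nilpotent structures: smooth, `g`-skew-symmetric endomorphisms of `𝐓M` of square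
zero and of constant rank. -/
structure IsTwoNilpotent (τ : ∀ x : M, BigTangent V x →ₗ[ℝ] BigTangent V x) : Prop where
  smooth : SmoothEndo V τ
  sq : ∀ (x : M) (a : BigTangent V x), τ x (τ x a) = 0
  skew : ∀ (x : M) (a b : BigTangent V x), neutral V x a (τ x b) + neutral V x (τ x a) b = 0
  const_rank : ∃ k : ℕ, ∀ x : M, Module.finrank ℝ (LinearMap.range (τ x)) = k

/-- `G` and `τ` are compatible: `G(τa, τb) = G(a, b)` for `a, b ∈ φ(im τ)`. -/
def IsCompatible (G : GenRiemannianMetric V M)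
    (τ : ∀ x : M, BigTangent V x →ₗ[ℝ] BigTangent V x) : Prop :=
  ∀ x : M, ∀ a ∈ (LinearMap.range (τ x)).map (G.φ x),
    ∀ b ∈ (LinearMap.range (τ x)).map (G.φ x),
      G.form V x (τ x a) (τ x b) = G.form V x a b

/-- `τ` is integrable: its Courant-Nijenhuis torsion vanishes. -/
def IsIntegrable (τ : ∀ x : M, BigTangent V x →ₗ[ℝ] BigTangent V x) : Prop :=
  ∀ a b : ∀ x : M, BigTangent V x, SmoothSection V a → SmoothSection V b →
    ∀ x : M, nijenhuis V τ a b x = 0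

/-- The set of generalized, metric, 2-nilpotent structures `τ` on `(M, G)` with `im τ = E`. -/
def MetricTwoNilpotent (G : GenRiemannianMetric V M) (E : Subbundle V M) :
    Set (∀ x : M, BigTangent V x →ₗ[ℝ] BigTangent V x) :=
  {τ | IsTwoNilpotent V τ ∧ (∀ x : M, LinearMap.range (τ x) = E.fiber x) ∧ IsCompatible V G τ}

/-- `(G|_E, lam)` is an almost Hermitian structure on `E`: `lam` is a smooth field of endomorphisms
of `E` with `lam² = -Id` (a complex structure on `E`) and it is compatible with `G|_E`. -/
structure IsAlmostHermitian (G : GenRiemannianMetric V M) (E : Subbundle V M)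
    (lam : ∀ x : M, E.fiber x →ₗ[ℝ] E.fiber x) : Prop where
  smooth : ∀ e : ∀ x : M, E.fiber x, E.IsSection V e → E.IsSection V (fun x => lam x (e x))
  sq : ∀ (x : M) (e : E.fiber x), lam x (lam x e) = -e
  compat : ∀ (x : M) (e₁ e₂ : E.fiber x),
    G.form V x (lam x e₁ : BigTangent V x) (lam x e₂ : BigTangent V x)
      = G.form V x (e₁ : BigTangent V x) (e₂ : BigTangent V x)

/-- The set of complex structures on `E` that are compatible with `G|_E`. -/
def CompatibleComplex (G : GenRiemannianMetric V M) (E : Subbundle V M) :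
    Set (∀ x : M, E.fiber x →ₗ[ℝ] E.fiber x) :=
  {lam | IsAlmostHermitian V G E lam}

/-- The bracket of the Lie algebroid `E` (the Courant bracket); its anchor is the projection
`(X, α) ↦ X`. -/
def Subbundle.bracket (E : Subbundle V M) (hE : E.CourantClosed V) (e₁ e₂ : ∀ x : M, E.fiber x)
    (h₁ : E.IsSection V e₁) (h₂ : E.IsSection V e₂) (x : M) : E.fiber x :=
  ⟨courant V (fun y => (e₁ y : BigTangent V y)) (fun y => (e₂ y : BigTangent V y)) x,
    hE e₁ e₂ h₁ h₂ x⟩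

/-- The value `(d_E η)(e₁, e₂, e₃)` of the Lie algebroid differential of a `2`-form `η` on `E`. -/
def Subbundle.dTwoForm (E : Subbundle V M) (hE : E.CourantClosed V)
    (η : ∀ x : M, E.fiber x →ₗ[ℝ] E.fiber x →ₗ[ℝ] ℝ) (e₁ e₂ e₃ : ∀ x : M, E.fiber x)
    (h₁ : E.IsSection V e₁) (h₂ : E.IsSection V e₂) (h₃ : E.IsSection V e₃) (x : M) : ℝ :=
  mvfderiv 𝓘(ℝ, V) (fun y => η y (e₂ y) (e₃ y)) x (e₁ x : BigTangent V x).1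
    - mvfderiv 𝓘(ℝ, V) (fun y => η y (e₁ y) (e₃ y)) x (e₂ x : BigTangent V x).1
    + mvfderiv 𝓘(ℝ, V) (fun y => η y (e₁ y) (e₂ y)) x (e₃ x : BigTangent V x).1
    - η x (E.bracket V hE e₁ e₂ h₁ h₂ x) (e₃ x)
    + η x (E.bracket V hE e₁ e₃ h₁ h₃ x) (e₂ x)
    - η x (E.bracket V hE e₂ e₃ h₂ h₃ x) (e₁ x)

/-- The fundamental form `ω(e₁, e₂) = G(lam e₁, e₂)` of `(G|_E, lam)`; equivalently
`G(e₁, e₂) = ω(e₁, lam e₂)`. -/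
def fundamentalForm (G : GenRiemannianMetric V M) (E : Subbundle V M)
    (lam : ∀ x : M, E.fiber x →ₗ[ℝ] E.fiber x) (x : M) :
    E.fiber x →ₗ[ℝ] E.fiber x →ₗ[ℝ] ℝ :=
  (G.form V x).compl₁₂ ((E.fiber x).subtype.comp (lam x)) (E.fiber x).subtype

/-- `(G|_E, lam)` is an almost Kähler structure on the Lie algebroid `E`: it is almost Hermitian and
its fundamental form is closed. -/
def IsAlmostKahler (G : GenRiemannianMetric V M) (E : Subbundle V M) (hE : E.CourantClosed V)
    (lam : ∀ x : M, E.fiber x →ₗ[ℝ] E.fiber x) : Prop :=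
  IsAlmostHermitian V G E lam ∧
    ∀ (e₁ e₂ e₃ : ∀ x : M, E.fiber x) (h₁ : E.IsSection V e₁) (h₂ : E.IsSection V e₂)
      (h₃ : E.IsSection V e₃) (x : M),
      E.dTwoForm V hE (fundamentalForm V G E lam) e₁ e₂ e₃ h₁ h₂ h₃ x = 0

end Structures

end GenGeom

end

open scoped Manifold ContDiff
open Bundle VectorField Filter Topology

noncomputable section

namespace GenGeom

section

variable {V : Type*} [NormedAddCommGroup V] [NormedSpace ℝ V]
  {M : Type*} [TopologicalSpace M] [ChartedSpace V M] [IsManifold 𝓘(ℝ, V) ∞ M]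

lemma range_modelSelf : Set.range 𝓘(ℝ, V) = Set.univ := by simp

lemma isInvertible_mfderiv_extChartAt_symm (x : M) {z : V}
    (hz : z ∈ (extChartAt 𝓘(ℝ, V) x).target) :
    (mfderiv 𝓘(ℝ, V) 𝓘(ℝ, V) (extChartAt 𝓘(ℝ, V) x).symm z).IsInvertible := by
  have := isInvertible_mfderivWithin_extChartAt_symm (I := 𝓘(ℝ, V)) hz
  rwa [range_modelSelf, mfderivWithin_univ] at this

lemma differentiableAt_mpullback_extChartAt_symm [CompleteSpace V] {X : ∀ x : M, TangentSpace 𝓘(ℝ, V) x}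
    {x : M} (hX : ContMDiffAt 𝓘(ℝ, V) (𝓘(ℝ, V).prod 𝓘(ℝ, V)) ∞
      (fun x => TotalSpace.mk' V (E := fun x : M => TangentSpace 𝓘(ℝ, V) x) x (X x)) x) :
    DifferentiableAt ℝ (fun z => (mpullback 𝓘(ℝ, V) 𝓘(ℝ, V) (extChartAt 𝓘(ℝ, V) x).symm X z : V))
      (extChartAt 𝓘(ℝ, V) x x) := by
  have h := contMDiffWithinAt_mpullbackWithin_extChartAt_symm (m := 1) (n := 2) (s := Set.univ)
    (hX.of_le (by simp)) uniqueMDiffOn_univ (Set.mem_univ _) (by norm_num)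
  rw [Set.preimage_univ, Set.inter_univ, range_modelSelf] at h
  have h' := h.contMDiffAt (extChartAt_target_mem_nhds x)
  rw [contMDiffAt_vectorSpace_iff_contDiffAt] at h'
  simp only [mpullbackWithin_univ] at h'
  exact h'.differentiableAt (by simp)

omit [IsManifold 𝓘(ℝ, V) ∞ M] in
lemma mvfderiv_eq_fderiv_extChartAt_symm {f : M → ℝ} {x : M}
    (hf : MDifferentiableAt 𝓘(ℝ, V) 𝓘(ℝ, ℝ) f x) (v : TangentSpace 𝓘(ℝ, V) x) :
    mvfderiv 𝓘(ℝ, V) f x v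
      = fderiv ℝ (fun z => f ((extChartAt 𝓘(ℝ, V) x).symm z)) (extChartAt 𝓘(ℝ, V) x x) v := by
  simp [mvfderiv, mfderiv, hf, writtenInExtChartAt, Function.comp_def]
  rfl

lemma lieDeriv_apply_eq {F : V → V →L[ℝ] ℝ} {X Y : V → V} {y : V} (hF : DifferentiableAt ℝ F y)
    (hY : DifferentiableAt ℝ Y y) :
    (fderiv ℝ F y (X y) + (F y).comp (fderiv ℝ X y)) (Y y)
      = fderiv ℝ (fun z => F z (Y z)) y (X y) - F y (lieBracket ℝ X Y y) := by
  rw [fderiv_clm_apply hF hY, lieBracket]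
  simp

lemma mlieBracket_eq_lieBracket_mpullback (X Y : ∀ x : M, TangentSpace 𝓘(ℝ, V) x) (x : M) :
    mlieBracket 𝓘(ℝ, V) X Y x = lieBracket ℝ
      (mpullback 𝓘(ℝ, V) 𝓘(ℝ, V) (extChartAt 𝓘(ℝ, V) x).symm X)
      (mpullback 𝓘(ℝ, V) 𝓘(ℝ, V) (extChartAt 𝓘(ℝ, V) x).symm Y)
      (extChartAt 𝓘(ℝ, V) x x) := by
  rw [mlieBracket, mlieBracketWithin_apply, range_modelSelf, Set.preimage_univ, Set.inter_univ,
    mpullbackWithin_univ, mpullbackWithin_univ, mfderiv_extChartAt_self]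
  refine (congrArg (fun L : V →L[ℝ] V => L _) ContinuousLinearMap.inverse_id).trans ?_
  exact congrFun (lieBracketWithin_univ (𝕜 := ℝ) (E := V)) _

lemma mpullback_extChartAt_symm_self (X : ∀ x : M, TangentSpace 𝓘(ℝ, V) x) (x : M) :
    (mpullback 𝓘(ℝ, V) 𝓘(ℝ, V) (extChartAt 𝓘(ℝ, V) x).symm X (extChartAt 𝓘(ℝ, V) x x) : V)
      = X x := by
  have h := mfderivWithin_range_extChartAt_symm (I := 𝓘(ℝ, V)) (x := x)
  rw [range_modelSelf, mfderivWithin_univ] at h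
  rw [mpullback_apply, h]
  have : (ContinuousLinearMap.id ℝ V).inverse = ContinuousLinearMap.id ℝ V :=
    ContinuousLinearMap.inverse_id
  have h2 : (X ((extChartAt 𝓘(ℝ, V) x).symm (extChartAt 𝓘(ℝ, V) x x)) : V) = X x :=
    congrArg (fun p : M => (X p : V)) (extChartAt_to_inv x)
  exact (congrArg (fun L : V →L[ℝ] V => L _) this).trans h2


lemma differentiableAt_comp_mfderiv_extChartAt_symm {μ : ∀ x : M, Cotangent V x}
    {x : M} (hμ : ContMDiffAt 𝓘(ℝ, V) (𝓘(ℝ, V).prod 𝓘(ℝ, V →L[ℝ] ℝ)) ∞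
      (fun x => TotalSpace.mk' (V →L[ℝ] ℝ) (E := fun x : M => TangentSpace 𝓘(ℝ, V) x →L[ℝ] ℝ)
        x (μ x)) x) :
    DifferentiableAt ℝ (fun z => ((μ ((extChartAt 𝓘(ℝ, V) x).symm z)).comp
      (mfderiv 𝓘(ℝ, V) 𝓘(ℝ, V) (extChartAt 𝓘(ℝ, V) x).symm z) : V →L[ℝ] ℝ))
      (extChartAt 𝓘(ℝ, V) x x) := by
  have h := ((contMDiffAt_hom_bundle _).1 hμ).2
  have h' := h.comp_of_eq (f := (extChartAt 𝓘(ℝ, V) x).symm) (x := extChartAt 𝓘(ℝ, V) x x)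
     ((contMDiffOn_extChartAt_symm x).contMDiffAt (extChartAt_target_mem_nhds x)) (by simp)
  have h2 := h'.contDiffAt.differentiableAt (by simp)
  refine h2.congr_of_eventuallyEq ?_
  filter_upwards [extChartAt_target_mem_nhds (I := 𝓘(ℝ, V)) x] with z hz
  have hz' : (extChartAt 𝓘(ℝ, V) x).symm z ∈ (chartAt V x).source := by
    simpa using (extChartAt 𝓘(ℝ, V) x).map_target hz
  have := TangentBundle.symmL_trivializationAt (I := 𝓘(ℝ, V)) hz'
  rw [(extChartAt 𝓘(ℝ, V) x).right_inv hz, range_modelSelf, mfderivWithin_univ] at this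
  simp [ContinuousLinearMap.inCoordinates]
  exact congrArg (fun L => (μ ((extChartAt 𝓘(ℝ, V) x).symm z)).comp L) this.symm


lemma lieDerivForm_apply [CompleteSpace V] {X Y : ∀ x : M, TangentSpace 𝓘(ℝ, V) x}
    {μ : ∀ x : M, Cotangent V x} {x : M}
    (hY : ContMDiffAt 𝓘(ℝ, V) (𝓘(ℝ, V).prod 𝓘(ℝ, V)) ∞
      (fun x => TotalSpace.mk' V (E := fun x : M => TangentSpace 𝓘(ℝ, V) x) x (Y x)) x)
    (hμ : ContMDiffAt 𝓘(ℝ, V) (𝓘(ℝ, V).prod 𝓘(ℝ, V →L[ℝ] ℝ)) ∞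
      (fun x => TotalSpace.mk' (V →L[ℝ] ℝ) (E := fun x : M => TangentSpace 𝓘(ℝ, V) x →L[ℝ] ℝ)
        x (μ x)) x)
    (hμY : MDifferentiableAt 𝓘(ℝ, V) 𝓘(ℝ, ℝ) (fun y => μ y (Y y)) x) :
    lieDerivForm V X μ x (Y x) =
      mvfderiv 𝓘(ℝ, V) (fun y => μ y (Y y)) x (X x) - μ x (mlieBracket 𝓘(ℝ, V) X Y x) := by
  have dY := differentiableAt_mpullback_extChartAt_symm hY
  have dμ := differentiableAt_comp_mfderiv_extChartAt_symm hμ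
  have eX := mpullback_extChartAt_symm_self X x
  have eY := mpullback_extChartAt_symm_self Y x
  have eμ : ((μ ((extChartAt 𝓘(ℝ, V) x).symm (extChartAt 𝓘(ℝ, V) x x))).comp
      (mfderiv 𝓘(ℝ, V) 𝓘(ℝ, V) (extChartAt 𝓘(ℝ, V) x).symm (extChartAt 𝓘(ℝ, V) x x)) :
        V →L[ℝ] ℝ) = μ x := by
    have h := mfderivWithin_range_extChartAt_symm (I := 𝓘(ℝ, V)) (x := x)
    rw [range_modelSelf, mfderivWithin_univ] at h
    have h2 : (μ ((extChartAt 𝓘(ℝ, V) x).symm (extChartAt 𝓘(ℝ, V) x x)) : V →L[ℝ] ℝ) = μ x :=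
      congrArg (fun p : M => (show V →L[ℝ] ℝ from μ p)) (extChartAt_to_inv x)
    rw [h]
    exact h2
  have hloc : (fun z => μ ((extChartAt 𝓘(ℝ, V) x).symm z) (Y ((extChartAt 𝓘(ℝ, V) x).symm z)))
      =ᶠ[𝓝 (extChartAt 𝓘(ℝ, V) x x)] fun z =>
        ((μ ((extChartAt 𝓘(ℝ, V) x).symm z)).comp
          (mfderiv 𝓘(ℝ, V) 𝓘(ℝ, V) (extChartAt 𝓘(ℝ, V) x).symm z) : V →L[ℝ] ℝ)
        (mpullback 𝓘(ℝ, V) 𝓘(ℝ, V) (extChartAt 𝓘(ℝ, V) x).symm Y z : V) := by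
    filter_upwards [extChartAt_target_mem_nhds (I := 𝓘(ℝ, V)) x] with z hz
    rw [mpullback_apply]
    exact congrArg (μ ((extChartAt 𝓘(ℝ, V) x).symm z))
      ((isInvertible_mfderiv_extChartAt_symm x hz).self_apply_inverse _).symm
  have key := lieDeriv_apply_eq (X := mpullback 𝓘(ℝ, V) 𝓘(ℝ, V) (extChartAt 𝓘(ℝ, V) x).symm X) dμ dY
  rw [eX, eY, eμ] at key
  rw [mvfderiv_eq_fderiv_extChartAt_symm hμY, hloc.fderiv_eq, mlieBracket_eq_lieBracket_mpullback,
    lieDerivForm, mfderiv_extChartAt_self]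
  refine Eq.trans ?_ key
  simp only [eX, eμ]
  rfl

end

section

variable {V : Type*} [NormedAddCommGroup V] [NormedSpace ℝ V]
  {M : Type*} [TopologicalSpace M] [ChartedSpace V M] [IsManifold 𝓘(ℝ, V) ∞ M]

/-- A section of the big tangent bundle is smooth at a point if its vector field and its `1`-form
are. -/
def SmoothSectionAt (a : ∀ x : M, BigTangent V x) (x : M) : Prop :=
  ContMDiffAt 𝓘(ℝ, V) (𝓘(ℝ, V).prod 𝓘(ℝ, V)) ∞
      (fun x => TotalSpace.mk' V (E := fun x : M => TangentSpace 𝓘(ℝ, V) x) x (a x).1) x ∧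
    ContMDiffAt 𝓘(ℝ, V) (𝓘(ℝ, V).prod 𝓘(ℝ, V →L[ℝ] ℝ)) ∞
      (fun x => TotalSpace.mk' (V →L[ℝ] ℝ) (E := fun x : M => TangentSpace 𝓘(ℝ, V) x →L[ℝ] ℝ)
        x (a x).2) x

lemma smoothSection_iff {a : ∀ x : M, BigTangent V x} :
    SmoothSection V a ↔ ∀ x, SmoothSectionAt a x := by
  simp only [SmoothSection, SmoothSectionOn, contMDiffOn_univ, SmoothSectionAt, ContMDiff,
    forall_and]

lemma SmoothSection.at {a : ∀ x : M, BigTangent V x} (h : SmoothSection V a) (x : M) :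
    SmoothSectionAt a x := smoothSection_iff.1 h x

lemma SmoothSectionAt.congr {a b : ∀ x : M, BigTangent V x} {x : M} (h : SmoothSectionAt a x)
    (hab : ∀ᶠ y in 𝓝 x, b y = a y) : SmoothSectionAt b x := by
  refine ⟨h.1.congr_of_eventuallyEq ?_, h.2.congr_of_eventuallyEq ?_⟩ <;>
  filter_upwards [hab] with y hy <;> rw [hy]

lemma SmoothSectionAt.smul {a : ∀ x : M, BigTangent V x} {x : M} {f : M → ℝ}
    (hf : ContMDiffAt 𝓘(ℝ, V) 𝓘(ℝ, ℝ) ∞ f x)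
    (h : SmoothSectionAt a x) : SmoothSectionAt (fun y => f y • a y) x :=
  ⟨hf.smul_section h.1, hf.smul_section h.2⟩

lemma SmoothSectionAt.add {a b : ∀ x : M, BigTangent V x} {x : M}
    (h : SmoothSectionAt a x) (h' : SmoothSectionAt b x) :
    SmoothSectionAt (fun y => a y + b y) x :=
  ⟨h.1.add_section h'.1, h.2.add_section h'.2⟩

lemma smoothSectionAt_zero (x : M) : SmoothSectionAt (fun y : M => (0 : BigTangent V y)) x :=
  ⟨(contMDiff_zeroSection ℝ (fun x : M => TangentSpace 𝓘(ℝ, V) x)).contMDiffAt,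
    (contMDiff_zeroSection ℝ (fun x : M => TangentSpace 𝓘(ℝ, V) x →L[ℝ] ℝ)).contMDiffAt⟩

lemma SmoothSectionAt.neg {a : ∀ x : M, BigTangent V x} {x : M}
    (h : SmoothSectionAt a x) : SmoothSectionAt (fun y => - a y) x :=
  ⟨h.1.neg_section, h.2.neg_section⟩

lemma SmoothSectionAt.sum {ι : Type*} (s : Finset ι) {a : ι → ∀ x : M, BigTangent V x} {x : M}
    (h : ∀ i ∈ s, SmoothSectionAt (a i) x) : SmoothSectionAt (fun y => ∑ i ∈ s, a i y) x := by
  classical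
  induction s using Finset.induction_on with
  | empty => simpa using smoothSectionAt_zero x
  | insert i s hi ih =>
    simp only [Finset.sum_insert hi]
    exact (h i (Finset.mem_insert_self i s)).add
      (ih fun j hj => h j (Finset.mem_insert_of_mem hj))

lemma SmoothSectionOn.at {a : ∀ x : M, BigTangent V x} {U : Set M} {x : M}
    (h : SmoothSectionOn V a U) (hU : U ∈ 𝓝 x) : SmoothSectionAt a x :=
  ⟨h.1.contMDiffAt hU, h.2.contMDiffAt hU⟩

/-- The pairing of a `1`-form with a vector field is smooth. -/
lemma SmoothSectionAt.contMDiffAt_apply {a b : ∀ x : M, BigTangent V x} {x : M}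
    (ha : SmoothSectionAt a x) (hb : SmoothSectionAt b x) :
    ContMDiffAt 𝓘(ℝ, V) 𝓘(ℝ, ℝ) ∞ (fun y => (a y).2 (b y).1) x := by
  have : ContMDiffAt 𝓘(ℝ, V) (𝓘(ℝ, V).prod 𝓘(ℝ, ℝ)) ∞
      (fun m ↦ TotalSpace.mk' ℝ (E := Bundle.Trivial M ℝ) m ((a m).2 (b m).1)) x :=
    ContMDiffAt.clm_bundle_apply (F₁ := V) (F₂ := ℝ)
      (E₁ := fun x : M => TangentSpace 𝓘(ℝ, V) x) ha.2 hb.1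
  simp only [contMDiffAt_totalSpace] at this
  exact this.2

lemma SmoothSectionAt.contMDiffAt_neutral {a b : ∀ x : M, BigTangent V x} {x : M}
    (ha : SmoothSectionAt a x) (hb : SmoothSectionAt b x) :
    ContMDiffAt 𝓘(ℝ, V) 𝓘(ℝ, ℝ) ∞ (fun y => neutral V y (a y) (b y)) x :=
  (ha.contMDiffAt_apply hb).add (hb.contMDiffAt_apply ha)

variable [FiniteDimensional ℝ V] [T2Space M]

/-- A section that is smooth on an open set agrees near each point with a global smooth section. -/
lemma SmoothSectionOn.exists_smoothSection {a : ∀ x : M, BigTangent V x} {U : Set M} {x : M}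
    (h : SmoothSectionOn V a U) (hU : IsOpen U) (hx : x ∈ U) :
    ∃ b : ∀ x : M, BigTangent V x, SmoothSection V b ∧ ∀ᶠ y in 𝓝 x, b y = a y := by
  obtain ⟨f, -, hf⟩ := (SmoothBumpFunction.nhds_basis_tsupport (I := 𝓘(ℝ, V)) x).mem_iff.1
    (hU.mem_nhds hx)
  refine ⟨fun y => f y • a y, ⟨?_, ?_⟩, ?_⟩
  · exact (ContMDiffOn.smul_section_of_tsupport f.contMDiff.contMDiffOn hU hf h.1).contMDiffOn
  · exact (ContMDiffOn.smul_section_of_tsupport f.contMDiff.contMDiffOn hU hf h.2).contMDiffOn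
  · filter_upwards [f.eventuallyEq_one] with y hy
    rw [hy, Pi.one_apply, one_smul]

/-- Every vector of the big tangent bundle is the value of a global smooth section. -/
lemma exists_smoothSection_eq {x : M} (c : BigTangent V x) :
    ∃ a : ∀ x : M, BigTangent V x, SmoothSection V a ∧ a x = c := by
  obtain ⟨s, hs, h⟩ := FiberBundle.exists_contMDiffOn_extend (k := ∞) 𝓘(ℝ, V) V
    (V := fun x : M => TangentSpace 𝓘(ℝ, V) x) c.1
  obtain ⟨t, ht, h'⟩ := FiberBundle.exists_contMDiffOn_extend (k := ∞) 𝓘(ℝ, V) (V →L[ℝ] ℝ)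
    (V := fun x : M => TangentSpace 𝓘(ℝ, V) x →L[ℝ] ℝ) c.2
  obtain ⟨U, hU, hUo, hx⟩ := mem_nhds_iff.1 (inter_mem hs ht)
  obtain ⟨b, hb, hbe⟩ := SmoothSectionOn.exists_smoothSection
    (a := fun y => (FiberBundle.extend V (E := fun x : M => TangentSpace 𝓘(ℝ, V) x) c.1 y,
      FiberBundle.extend (V →L[ℝ] ℝ) (E := fun x : M => TangentSpace 𝓘(ℝ, V) x →L[ℝ] ℝ) c.2 y))
    (U := U) (x := x)
    ⟨h.mono fun y hy => (hU hy).1, h'.mono fun y hy => (hU hy).2⟩ hUo hx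
  exact ⟨b, hb, hbe.self_of_nhds.trans (by simp)⟩

end

section

variable {V : Type*} [NormedAddCommGroup V] [NormedSpace ℝ V]
  {M : Type*} [TopologicalSpace M] [ChartedSpace V M] 

section Algebra

lemma neutral_apply (x : M) (a b : BigTangent V x) :
    neutral V x a b = a.2 b.1 + b.2 a.1 := rfl

lemma neutral_comm (x : M) (a b : BigTangent V x) : neutral V x a b = neutral V x b a :=
  add_comm _ _

lemma eq_zero_of_neutral_eq_zero {x : M} {a : BigTangent V x}
    (h : ∀ b, neutral V x a b = 0) : a = 0 := by
  have h2 : a.2 = 0 := by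
    ext v
    simpa [neutral_apply] using h (v, 0)
  have h1 : a.1 = 0 := SeparatingDual.eq_zero_of_forall_dual_eq_zero (R := ℝ) (V := V) fun μ => by
    calc μ a.1 = a.2 0 + μ a.1 := by rw [map_zero, zero_add]
      _ = 0 := h (0, μ)
  exact Prod.ext h1 h2

end Algebra

variable [IsManifold 𝓘(ℝ, V) ∞ M]

omit [IsManifold 𝓘(ℝ, V) ∞ M] in
lemma courant_skew (a b : ∀ x : M, BigTangent V x) (x : M) :
    courant V a b x = - courant V b a x := by
  have h : (fun y => (b y).2 (a y).1 - (a y).2 (b y).1)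
      = -(fun y => (a y).2 (b y).1 - (b y).2 (a y).1) := by
    ext y; simp
  refine Prod.ext mlieBracket_swap_apply ?_
  simp only [courant, Prod.snd_neg]
  rw [h, mvfderiv_neg]
  module

/-- The neutral metric is invariant under the Courant bracket up to the exact terms which measure
the difference to the Dorfman bracket. -/
lemma mvfderiv_neutral [CompleteSpace V] {a b c : ∀ x : M, BigTangent V x} {x : M}
    (ha : SmoothSectionAt a x) (hb : SmoothSectionAt b x) (hc : SmoothSectionAt c x) :
    mvfderiv 𝓘(ℝ, V) (fun y => neutral V y (b y) (c y)) x (a x).1 =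
      neutral V x (courant V a b x) (c x) + neutral V x (b x) (courant V a c x)
      + 1 / 2 * mvfderiv 𝓘(ℝ, V) (fun y => neutral V y (a y) (b y)) x (c x).1
      + 1 / 2 * mvfderiv 𝓘(ℝ, V) (fun y => neutral V y (a y) (c y)) x (b x).1 := by
  have D : ∀ {a b : ∀ x : M, BigTangent V x}, SmoothSectionAt a x → SmoothSectionAt b x →
      MDifferentiableAt 𝓘(ℝ, V) 𝓘(ℝ, ℝ) (fun y => (a y).2 (b y).1) x := fun h h' =>
    (h.contMDiffAt_apply h').mdifferentiableAt (by simp)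
  have N : ∀ {a b : ∀ x : M, BigTangent V x}, SmoothSectionAt a x → SmoothSectionAt b x →
      ∀ v, mvfderiv 𝓘(ℝ, V) (fun y => neutral V y (a y) (b y)) x v =
        mvfderiv 𝓘(ℝ, V) (fun y => (a y).2 (b y).1) x v
          + mvfderiv 𝓘(ℝ, V) (fun y => (b y).2 (a y).1) x v := fun h h' v =>
    congrArg (fun L => L v) (mvfderiv_add (D h h') (D h' h))
  have S : ∀ {a b : ∀ x : M, BigTangent V x}, SmoothSectionAt a x → SmoothSectionAt b x →
      ∀ v, mvfderiv 𝓘(ℝ, V) (fun y => (a y).2 (b y).1 - (b y).2 (a y).1) x v =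
        mvfderiv 𝓘(ℝ, V) (fun y => (a y).2 (b y).1) x v
          - mvfderiv 𝓘(ℝ, V) (fun y => (b y).2 (a y).1) x v := fun h h' v =>
    congrArg (fun L => L v) (mvfderiv_sub (D h h') (D h' h))
  have K : ∀ {a b c : ∀ x : M, BigTangent V x}, SmoothSectionAt a x → SmoothSectionAt b x →
      SmoothSectionAt c x → neutral V x (courant V a b x) (c x) =
        (mvfderiv 𝓘(ℝ, V) (fun y => (b y).2 (c y).1) x (a x).1
          - (b x).2 (mlieBracket 𝓘(ℝ, V) (fun y => (a y).1) (fun y => (c y).1) x))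
        - (mvfderiv 𝓘(ℝ, V) (fun y => (a y).2 (c y).1) x (b x).1
          - (a x).2 (mlieBracket 𝓘(ℝ, V) (fun y => (b y).1) (fun y => (c y).1) x))
        + 1 / 2 * (mvfderiv 𝓘(ℝ, V) (fun y => (a y).2 (b y).1) x (c x).1
          - mvfderiv 𝓘(ℝ, V) (fun y => (b y).2 (a y).1) x (c x).1)
        + (c x).2 (mlieBracket 𝓘(ℝ, V) (fun y => (a y).1) (fun y => (b y).1) x) := by
    intro a b c ha hb hc
    have h₁ := lieDerivForm_apply (X := fun y => (a y).1) hc.1 hb.2 (D hb hc)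
    have h₂ := lieDerivForm_apply (X := fun y => (b y).1) hc.1 ha.2 (D ha hc)
    rw [← h₁, ← h₂, ← S ha hb]
    rfl
  rw [neutral_comm x (b x), K ha hb hc, K ha hc hb, N hb hc, N ha hb, N ha hc,
    mlieBracket_swap_apply (V := fun y => (c y).1) (W := fun y => (b y).1), map_neg]
  ring

end

section

section Matrix

variable {V : Type*} [NormedAddCommGroup V] [NormedSpace ℝ V]
  {M : Type*} [TopologicalSpace M] [ChartedSpace V M]
  {n : Type*} [Fintype n] [DecidableEq n]

lemma contMDiffAt_det {A : M → Matrix n n ℝ} {x : M}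
    (h : ∀ i j, ContMDiffAt 𝓘(ℝ, V) 𝓘(ℝ, ℝ) ∞ (fun y => A y i j) x) :
    ContMDiffAt 𝓘(ℝ, V) 𝓘(ℝ, ℝ) ∞ (fun y => (A y).det) x := by
  simp only [Matrix.det_apply']
  exact contMDiffAt_finsetSum fun σ _ =>
    contMDiffAt_const.mul (contMDiffAt_finsetProd fun i _ => h (σ i) i)

lemma contMDiffAt_matrix_inv {A : M → Matrix n n ℝ} {x : M}
    (h : ∀ i j, ContMDiffAt 𝓘(ℝ, V) 𝓘(ℝ, ℝ) ∞ (fun y => A y i j) x) (hx : (A x).det ≠ 0) (i j : n) :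
    ContMDiffAt 𝓘(ℝ, V) 𝓘(ℝ, ℝ) ∞ (fun y => (A y)⁻¹ i j) x := by
  simp only [Matrix.inv_def, Ring.inverse_eq_inv', Matrix.smul_apply, smul_eq_mul,
    Matrix.adjugate_apply]
  refine ((contMDiffAt_det h).inv₀ hx).mul (contMDiffAt_det fun k l => ?_)
  simp only [Matrix.updateRow_apply]
  split_ifs
  exacts [contMDiffAt_const, h k l]

end Matrix

variable {V : Type*} [NormedAddCommGroup V] [NormedSpace ℝ V]
  {M : Type*} [TopologicalSpace M] [ChartedSpace V M] [IsManifold 𝓘(ℝ, V) ∞ M]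

namespace GenRiemannianMetric

variable (G : GenRiemannianMetric V M)

lemma form_apply (x : M) (a b : BigTangent V x) : G.form V x a b = neutral V x (G.φ x a) b := rfl

lemma neutral_φ_left (x : M) (a b : BigTangent V x) :
    neutral V x (G.φ x a) b = neutral V x a (G.φ x b) := by
  rw [← G.φ_isometry x a, G.φ_sq]

lemma neutral_eq_form (x : M) (a b : BigTangent V x) :
    neutral V x a b = G.form V x (G.φ x a) b := by
  rw [form_apply, G.φ_sq]

lemma form_comm (x : M) (a b : BigTangent V x) : G.form V x a b = G.form V x b a := by
  rw [form_apply, neutral_φ_left, neutral_comm, form_apply]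

lemma form_φ (x : M) (a b : BigTangent V x) :
    G.form V x (G.φ x a) (G.φ x b) = G.form V x a b := by
  rw [form_apply, G.φ_isometry, form_apply]

lemma eq_zero_of_form_self {x : M} {a : BigTangent V x} (h : G.form V x a a = 0) : a = 0 := by
  by_contra ha
  exact (G.pos x a ha).ne' h

lemma contMDiffAt_form {a b : ∀ x : M, BigTangent V x} (ha : SmoothSection V a)
    (hb : SmoothSection V b) (x : M) :
    ContMDiffAt 𝓘(ℝ, V) 𝓘(ℝ, ℝ) ∞ (fun y => G.form V y (a y) (b y)) x :=
  ((G.smooth a ha).at x).contMDiffAt_neutral (hb.at x)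

variable [FiniteDimensional ℝ V] (E : Subbundle V M)

lemma isCompl_orthogonal (x : M) :
    IsCompl (E.fiber x) (LinearMap.BilinForm.orthogonal (G.form V x) (E.fiber x)) := by
  have : FiniteDimensional ℝ (BigTangent V x) :=
    inferInstanceAs (FiniteDimensional ℝ (V × (V →L[ℝ] ℝ)))
  refine LinearMap.BilinForm.isCompl_orthogonal_of_restrict_nondegenerate ?_ ?_
  · intro a b h
    rw [← h, form_comm]
  · refine ⟨fun e he => ?_, fun e he => ?_⟩ <;>
    exact Subtype.ext (G.eq_zero_of_form_self (he e))

/-- The `G`-orthogonal projection of `𝐓M` onto a subbundle. -/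
def proj (x : M) : BigTangent V x →ₗ[ℝ] E.fiber x :=
  (E.fiber x).projectionOnto _ (G.isCompl_orthogonal E x)

variable {E}

lemma form_proj_right {x : M} (a : BigTangent V x) {e : BigTangent V x} (he : e ∈ E.fiber x) :
    G.form V x e (G.proj E x a) = G.form V x e a := by
  have h : a - G.proj E x a ∈ LinearMap.BilinForm.orthogonal (G.form V x) (E.fiber x) := by
    rw [← Submodule.projectionOnto_apply_eq_zero_iff (G.isCompl_orthogonal E x), map_sub,
      Submodule.projectionOnto_apply_left, sub_eq_zero]
    rfl
  have h' : G.form V x e (a - G.proj E x a) = 0 := h e he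
  rw [map_sub, sub_eq_zero] at h'
  exact h'.symm

lemma form_proj_left {x : M} (a : BigTangent V x) {e : BigTangent V x} (he : e ∈ E.fiber x) :
    G.form V x (G.proj E x a) e = G.form V x a e := by
  rw [form_comm, form_proj_right G a he, form_comm]

lemma proj_of_mem {x : M} {e : BigTangent V x} (he : e ∈ E.fiber x) :
    G.proj E x e = ⟨e, he⟩ :=
  Submodule.projectionOnto_apply_of_mem_left _ he

omit [FiniteDimensional ℝ V] in
lemma eq_of_form_eq {x : M} {e e' : BigTangent V x} (he : e ∈ E.fiber x) (he' : e' ∈ E.fiber x)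
    (h : ∀ c ∈ E.fiber x, G.form V x e c = G.form V x e' c) : e = e' := by
  rw [← sub_eq_zero]
  apply G.eq_zero_of_form_self
  rw [LinearMap.map_sub₂, h _ (sub_mem he he'), sub_self]

/-- The coefficients of the `G`-orthogonal projection in a frame `s` are obtained from the Gram
matrix of `s`. -/
lemma proj_eq_sum {x : M} {n : Type*} [Fintype n] [DecidableEq n] {s : n → BigTangent V x}
    (hs : Submodule.span ℝ (Set.range s) = E.fiber x) {A : Matrix n n ℝ}
    (hA : ∀ i j, A i j = G.form V x (s i) (s j)) (hdet : A.det ≠ 0) (a : BigTangent V x) :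
    (G.proj E x a : BigTangent V x) =
      ∑ i, (∑ j, G.form V x a (s j) * A⁻¹ j i) • s i := by
  have hmem : ∀ i, s i ∈ E.fiber x := fun i => hs ▸ Submodule.subset_span ⟨i, rfl⟩
  refine G.eq_of_form_eq (E := E) (Subtype.property _)
    (Submodule.sum_mem _ fun i _ => Submodule.smul_mem _ _ (hmem i)) fun c hc => ?_
  rw [form_proj_left G a hc]
  rw [← hs] at hc
  induction hc using Submodule.span_induction with
  | mem c hc =>
    obtain ⟨k, rfl⟩ := hc
    have h : Matrix.vecMul (Matrix.vecMul (fun j => G.form V x a (s j)) A⁻¹) A k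
        = G.form V x a (s k) := by
      rw [Matrix.vecMul_vecMul, Matrix.nonsing_inv_mul _ (isUnit_iff_ne_zero.2 hdet),
        Matrix.vecMul_one]
    rw [← h]
    simp [Matrix.vecMul, dotProduct, hA]
  | zero => simp
  | add c d _ _ hc hd => rw [map_add, hc, hd, map_add]
  | smul r c _ hc => rw [map_smul, hc, map_smul]

omit [FiniteDimensional ℝ V] in
lemma det_gram_ne_zero {x : M} {n : Type*} [Fintype n] [DecidableEq n] {s : n → BigTangent V x}
    (hs : LinearIndependent ℝ s) {A : Matrix n n ℝ}
    (hA : ∀ i j, A i j = G.form V x (s i) (s j)) : A.det ≠ 0 := by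
  intro h
  obtain ⟨w, hw, hwA⟩ := Matrix.exists_vecMul_eq_zero_iff.2 h
  apply hw
  have h0 : ∑ i, w i • s i = 0 := by
    apply G.eq_zero_of_form_self
    rw [map_sum (G.form V x (∑ i, w i • s i))]
    refine Finset.sum_eq_zero fun k _ => ?_
    have := congrFun hwA k
    simp only [Matrix.vecMul, dotProduct, hA, Pi.zero_apply] at this
    simp [this]
  exact funext fun i => Fintype.linearIndependent_iff.1 hs w h0 i

lemma smoothSection_proj [T2Space M] {a : ∀ x : M, BigTangent V x} (ha : SmoothSection V a) :
    SmoothSection V (fun x => (G.proj E x (a x) : BigTangent V x)) := by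
  rw [smoothSection_iff]
  intro x
  obtain ⟨U, hU, hx, s, hs, hsU⟩ := E.exists_frame x
  choose b hb hbs using fun i => (hs i).exists_smoothSection hU hx
  let A : M → Matrix (Fin E.rank) (Fin E.rank) ℝ := fun y => .of fun i j => G.form V y (b i y) (b j y)
  have hbU : ∀ᶠ y in 𝓝 x, (∀ i, b i y = s i y) ∧ y ∈ U :=
    (eventually_all.2 hbs).and (hU.mem_nhds hx)
  have hdet : ∀ᶠ y in 𝓝 x, (A y).det ≠ 0 := by
    filter_upwards [hbU] with y hy
    refine G.det_gram_ne_zero (s := fun i => b i y) ?_ fun i j => rfl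
    simp only [hy.1]
    exact (hsU y hy.2).1
  have hA : ∀ i j, ContMDiffAt 𝓘(ℝ, V) 𝓘(ℝ, ℝ) ∞ (fun y => A y i j) x := fun i j =>
    G.contMDiffAt_form (hb i) (hb j) x
  have key : SmoothSectionAt (fun y => ∑ i, (∑ j, G.form V y (a y) (b j y) * (A y)⁻¹ j i) • b i y)
      x :=
    SmoothSectionAt.sum _ fun i _ => SmoothSectionAt.smul (contMDiffAt_finsetSum fun j _ =>
      (G.contMDiffAt_form ha (hb j) x).mul
        (contMDiffAt_matrix_inv hA hdet.self_of_nhds j i)) ((hb i).at x)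
  refine key.congr ?_
  filter_upwards [hbU, hdet] with y hy hy'
  refine G.proj_eq_sum (s := fun i => b i y) ?_ (fun i j => rfl) hy' _
  simp only [hy.1]
  exact (hsU y hy.2).2

end GenRiemannianMetric

end

section

variable {V : Type*} [NormedAddCommGroup V] [NormedSpace ℝ V]
  {M : Type*} [TopologicalSpace M] [ChartedSpace V M] [IsManifold 𝓘(ℝ, V) ∞ M]
  {G : GenRiemannianMetric V M} {E : Subbundle V M}

namespace IsTwoNilpotent

variable {τ : ∀ x : M, BigTangent V x →ₗ[ℝ] BigTangent V x}

lemma neutral_left (h : IsTwoNilpotent V τ) (x : M) (a b : BigTangent V x) :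
    neutral V x (τ x a) b = - neutral V x a (τ x b) :=
  eq_neg_of_add_eq_zero_right (h.skew x a b)

end IsTwoNilpotent

namespace MetricTwoNilpotent

variable {τ : ∀ x : M, BigTangent V x →ₗ[ℝ] BigTangent V x}

lemma apply_mem (h : τ ∈ MetricTwoNilpotent V G E) (x : M) (a : BigTangent V x) :
    τ x a ∈ E.fiber x :=
  h.2.1 x ▸ LinearMap.mem_range_self _ a

/-- The endomorphism `τ ∘ φ` of `E`. -/
def toComplex (h : τ ∈ MetricTwoNilpotent V G E) (x : M) : E.fiber x →ₗ[ℝ] E.fiber x :=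
  ((τ x).comp ((G.φ x).comp (E.fiber x).subtype)).codRestrict _ fun _ => apply_mem h x _

lemma coe_toComplex (h : τ ∈ MetricTwoNilpotent V G E) (x : M) (e : E.fiber x) :
    (toComplex h x e : BigTangent V x) = τ x (G.φ x e) := rfl

lemma form_toComplex_left (h : τ ∈ MetricTwoNilpotent V G E) (x : M) (e e' : E.fiber x) :
    G.form V x (toComplex h x e) e' = - G.form V x e (toComplex h x e') := by
  rw [G.form_apply, G.neutral_φ_left, coe_toComplex, h.1.neutral_left, G.form_apply, coe_toComplex]

lemma form_toComplex (h : τ ∈ MetricTwoNilpotent V G E) (x : M) (e e' : E.fiber x) :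
    G.form V x (toComplex h x e) (toComplex h x e') = G.form V x e e' := by
  have hmem : ∀ e : E.fiber x, G.φ x e ∈ (LinearMap.range (τ x)).map (G.φ x) := fun e =>
    ⟨e, by rw [h.2.1 x]; exact e.2, rfl⟩
  rw [coe_toComplex, coe_toComplex, h.2.2 x _ (hmem e) _ (hmem e'), G.form_φ]

lemma isAlmostHermitian_toComplex (h : τ ∈ MetricTwoNilpotent V G E) :
    IsAlmostHermitian V G E (toComplex h) where
  smooth e he := h.1.smooth _ (G.smooth _ he)
  sq x e := by
    refine Subtype.ext (G.eq_of_form_eq (E := E) (Subtype.property _) (Subtype.property _)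
      fun c hc => ?_)
    have h₁ := form_toComplex_left h x (toComplex h x e) ⟨c, hc⟩
    rw [form_toComplex] at h₁
    rw [h₁, Submodule.coe_neg, LinearMap.map_neg₂]
  compat := form_toComplex h

/-- Every section of `E` is of the form `τ a`. -/
lemma exists_eq_apply (h : τ ∈ MetricTwoNilpotent V G E) {e : ∀ x : M, E.fiber x}
    (he : E.IsSection V e) :
    ∃ a : ∀ x : M, BigTangent V x, SmoothSection V a ∧ e = fun x => ⟨τ x (a x), apply_mem h x _⟩ := by
  have H := isAlmostHermitian_toComplex h
  refine ⟨fun x => G.φ x (-(toComplex h x (e x) : BigTangent V x)), G.smooth _ ?_, ?_⟩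
  · exact smoothSection_iff.2 fun x => (SmoothSection.at (H.smooth e he) x).neg
  · funext x
    refine Subtype.ext ?_
    have := congrArg (Subtype.val) (H.sq x (e x))
    rw [coe_toComplex, Submodule.coe_neg] at this
    simp only [map_neg, this, neg_neg]

lemma fundamentalForm_apply (h : τ ∈ MetricTwoNilpotent V G E) (x : M) (e : E.fiber x)
    (c : BigTangent V x) (hc : τ x c ∈ E.fiber x) :
    fundamentalForm V G E (toComplex h) x e ⟨τ x c, hc⟩ = neutral V x e c := by
  have h₁ : fundamentalForm V G E (toComplex h) x e ⟨τ x c, hc⟩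
      = neutral V x (G.φ x (toComplex h x e)) (τ x c) := rfl
  have h₂ := congrArg Subtype.val ((isAlmostHermitian_toComplex h).sq x e)
  rw [coe_toComplex, Submodule.coe_neg] at h₂
  rw [h₁, ← neg_eq_iff_eq_neg.2 (h.1.neutral_left x _ c), h₂, LinearMap.map_neg₂, neg_neg]

variable [FiniteDimensional ℝ V]

/-- The exterior differential of the fundamental form is, up to sign, the Courant-Nijenhuis torsion
with the last index lowered by the neutral metric. -/
lemma dTwoForm_eq_neg_neutral_nijenhuis (hE : E.IsIsotropic V) (h : τ ∈ MetricTwoNilpotent V G E)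
    (hC : E.CourantClosed V) {a b c : ∀ x : M, BigTangent V x} (ha : SmoothSection V a)
    (hb : SmoothSection V b) (hc : SmoothSection V c) (x : M) :
    E.dTwoForm V hC (fundamentalForm V G E (toComplex h))
      (fun x => ⟨τ x (a x), apply_mem h x _⟩) (fun x => ⟨τ x (b x), apply_mem h x _⟩)
      (fun x => ⟨τ x (c x), apply_mem h x _⟩) (h.1.smooth a ha) (h.1.smooth b hb)
      (h.1.smooth c hc) x = - neutral V x (nijenhuis V τ a b x) (c x) := by
  have : CompleteSpace V := FiniteDimensional.complete ℝ V
  have skew := h.1.neutral_left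
  have flip : ∀ a b : ∀ x : M, BigTangent V x, ∀ v,
      mvfderiv 𝓘(ℝ, V) (fun y => neutral V y (τ y (a y)) (b y)) x v =
        - mvfderiv 𝓘(ℝ, V) (fun y => neutral V y (a y) (τ y (b y))) x v := by
    intro a b v
    have : (fun y => neutral V y (τ y (a y)) (b y)) = -fun y => neutral V y (a y) (τ y (b y)) :=
      funext fun y => skew y _ _
    rw [this, mvfderiv_neg]
    rfl
  have iso : ∀ a b : ∀ x : M, BigTangent V x, ∀ v,
      mvfderiv 𝓘(ℝ, V) (fun y => neutral V y (τ y (a y)) (τ y (b y))) x v = 0 := by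
    intro a b v
    have : (fun y => neutral V y (τ y (a y)) (τ y (b y))) = 0 :=
      funext fun y => hE y _ (apply_mem h y _) _ (apply_mem h y _)
    rw [this, mvfderiv_zero]
    rfl
  have ha' := (h.1.smooth a ha).at x
  have hb' := (h.1.smooth b hb).at x
  have hc' := (h.1.smooth c hc).at x
  have h₁ := mvfderiv_neutral ha' (hb.at x) hc'
  have h₂ := mvfderiv_neutral hb' (ha.at x) hc'
  have h₃ : mvfderiv 𝓘(ℝ, V) (fun y => neutral V y (τ y (b y)) (a y)) x (τ x (c x)).1
      = - mvfderiv 𝓘(ℝ, V) (fun y => neutral V y (τ y (a y)) (b y)) x (τ x (c x)).1 := by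
    rw [flip]
    simp only [neutral_comm]
  rw [iso] at h₁ h₂
  rw [h₃, courant_skew _ a, LinearMap.map_neg₂, neutral_comm x (a x)] at h₂
  rw [neutral_comm x (b x)] at h₁
  simp only [Subbundle.dTwoForm, fundamentalForm_apply, Subbundle.bracket]
  rw [flip b c, flip a c, h₁, h₂]
  simp only [nijenhuis, LinearMap.map_add₂, LinearMap.map_sub₂, skew, h.1.sq, map_zero,
    LinearMap.zero_apply]
  ring

end MetricTwoNilpotent

end

section

variable {V : Type*} [NormedAddCommGroup V] [NormedSpace ℝ V] [FiniteDimensional ℝ V]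
  {M : Type*} [TopologicalSpace M] [ChartedSpace V M] [IsManifold 𝓘(ℝ, V) ∞ M]
  {G : GenRiemannianMetric V M} {E : Subbundle V M}

namespace IsAlmostHermitian

variable {lam : ∀ x : M, E.fiber x →ₗ[ℝ] E.fiber x}

omit [FiniteDimensional ℝ V] in
lemma form_left (h : IsAlmostHermitian V G E lam) (x : M) (e e' : E.fiber x) :
    G.form V x (lam x e) e' = - G.form V x e (lam x e') := by
  rw [← h.compat x (lam x e) e', h.sq, Submodule.coe_neg, LinearMap.map_neg₂]

end IsAlmostHermitian

variable (G) in
/-- The endomorphism of `𝐓M` which vanishes on the `g`-orthogonal space of `E` and is `lam ∘ φ` on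
`φ(E)`. -/
def toNilpotent (lam : ∀ x : M, E.fiber x →ₗ[ℝ] E.fiber x) (x : M) :
    BigTangent V x →ₗ[ℝ] BigTangent V x :=
  (E.fiber x).subtype.comp ((lam x).comp ((G.proj E x).comp (G.φ x)))

lemma toNilpotent_apply (lam : ∀ x : M, E.fiber x →ₗ[ℝ] E.fiber x) (x : M) (a : BigTangent V x) :
    toNilpotent G lam x a = lam x (G.proj E x (G.φ x a)) := rfl

lemma toNilpotent_φ (lam : ∀ x : M, E.fiber x →ₗ[ℝ] E.fiber x) (x : M) (e : E.fiber x) :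
    toNilpotent G lam x (G.φ x e) = lam x e := by
  rw [toNilpotent_apply, G.φ_sq, G.proj_of_mem e.2]

lemma proj_φ_of_mem (hE : E.IsIsotropic V) {x : M} {e : BigTangent V x} (he : e ∈ E.fiber x) :
    G.proj E x (G.φ x e) = 0 := by
  refine Subtype.ext (G.eq_of_form_eq (E := E) (Subtype.property _) (Subtype.property _)
    fun c hc => ?_)
  rw [G.form_proj_left _ hc, ← G.neutral_eq_form, hE x e he c hc, Submodule.coe_zero,
    LinearMap.map_zero₂]

lemma range_toNilpotent {lam : ∀ x : M, E.fiber x →ₗ[ℝ] E.fiber x}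
    (h : IsAlmostHermitian V G E lam) (x : M) :
    LinearMap.range (toNilpotent G lam x) = E.fiber x := by
  refine le_antisymm ?_ fun e he => ⟨G.φ x (lam x (-⟨e, he⟩)), ?_⟩
  · rintro _ ⟨a, rfl⟩
    exact Subtype.property _
  · rw [toNilpotent_φ, h.sq]
    exact neg_neg e

omit [FiniteDimensional ℝ V] in
lemma finrank_fiber (E : Subbundle V M) (x : M) : Module.finrank ℝ (E.fiber x) = E.rank := by
  obtain ⟨U, -, hx, s, -, hs⟩ := E.exists_frame x
  rw [← (hs x hx).2, finrank_span_eq_card (hs x hx).1, Fintype.card_fin]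

lemma neutral_toNilpotent (lam : ∀ x : M, E.fiber x →ₗ[ℝ] E.fiber x) (x : M)
    (a b : BigTangent V x) :
    neutral V x a (toNilpotent G lam x b)
      = G.form V x (G.proj E x (G.φ x a)) (lam x (G.proj E x (G.φ x b))) := by
  rw [G.neutral_eq_form, G.form_proj_left _ (Subtype.property _), toNilpotent_apply]

lemma toNilpotent_mem [T2Space M] (hE : E.IsIsotropic V)
    {lam : ∀ x : M, E.fiber x →ₗ[ℝ] E.fiber x} (h : IsAlmostHermitian V G E lam) :
    toNilpotent G lam ∈ MetricTwoNilpotent V G E := by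
  refine ⟨⟨fun a ha => h.smooth _ (G.smoothSection_proj (G.smooth a ha)), fun x a => ?_,
    fun x a b => ?_, E.rank, fun x => ?_⟩, range_toNilpotent h, ?_⟩
  · rw [toNilpotent_apply, toNilpotent_apply, proj_φ_of_mem hE (Subtype.property _),
      LinearMap.map_zero,
      Submodule.coe_zero]
  · rw [neutral_comm x (toNilpotent G lam x a), neutral_toNilpotent, neutral_toNilpotent,
      G.form_comm x (G.proj E x (G.φ x b) : BigTangent V x), h.form_left, add_neg_cancel]
  · rw [range_toNilpotent h, finrank_fiber]
  · rintro x a ⟨e, he, rfl⟩ b ⟨e', he', rfl⟩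
    rw [range_toNilpotent h] at he he'
    rw [toNilpotent_φ lam x ⟨e, he⟩, toNilpotent_φ lam x ⟨e', he'⟩, h.compat, G.form_φ]

lemma toNilpotent_toComplex {τ : ∀ x : M, BigTangent V x →ₗ[ℝ] BigTangent V x}
    (h : τ ∈ MetricTwoNilpotent V G E) :
    toNilpotent G (MetricTwoNilpotent.toComplex h) = τ := by
  funext x
  refine LinearMap.ext fun a => sub_eq_zero.1 (eq_zero_of_neutral_eq_zero fun b => ?_)
  rw [toNilpotent_apply, MetricTwoNilpotent.coe_toComplex, LinearMap.map_sub₂, h.1.neutral_left,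
    h.1.neutral_left, ← G.form_apply, G.form_proj_left _ (MetricTwoNilpotent.apply_mem h x b),
    ← G.neutral_eq_form, sub_self]

open MetricTwoNilpotent in
variable (G) in
/-- The bijection `τ ↦ τ ∘ φ|_E`. -/
def nilpotentEquivComplex [T2Space M] (hE : E.IsIsotropic V) :
    MetricTwoNilpotent V G E ≃ CompatibleComplex V G E where
  toFun τ := ⟨toComplex τ.2, isAlmostHermitian_toComplex τ.2⟩
  invFun lam := ⟨toNilpotent G lam.1, toNilpotent_mem hE lam.2⟩
  left_inv τ := Subtype.ext (toNilpotent_toComplex τ.2)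
  right_inv lam := Subtype.ext (funext fun x => LinearMap.ext fun e =>
    Subtype.ext (toNilpotent_φ lam.1 x e))

open MetricTwoNilpotent in
omit [FiniteDimensional ℝ V] in
lemma courantClosed_of_isIntegrable {τ : ∀ x : M, BigTangent V x →ₗ[ℝ] BigTangent V x}
    (h : τ ∈ MetricTwoNilpotent V G E) (hτ : IsIntegrable V τ) : E.CourantClosed V := by
  intro e₁ e₂ h₁ h₂ x
  obtain ⟨a, ha, rfl⟩ := exists_eq_apply h h₁
  obtain ⟨b, hb, rfl⟩ := exists_eq_apply h h₂
  have := hτ a b ha hb x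
  rw [nijenhuis, h.1.sq, add_zero, sub_sub, sub_eq_zero] at this
  rw [this]
  exact add_mem (apply_mem h x _) (apply_mem h x _)

open MetricTwoNilpotent in
lemma isIntegrable_iff [T2Space M] (hE : E.IsIsotropic V)
    {τ : ∀ x : M, BigTangent V x →ₗ[ℝ] BigTangent V x} (h : τ ∈ MetricTwoNilpotent V G E) :
    IsIntegrable V τ ↔ ∃ hC : E.CourantClosed V, IsAlmostKahler V G E hC (toComplex h) := by
  refine ⟨fun hτ => ⟨courantClosed_of_isIntegrable h hτ, isAlmostHermitian_toComplex h, ?_⟩, ?_⟩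
  · intro e₁ e₂ e₃ h₁ h₂ h₃ x
    obtain ⟨a, ha, rfl⟩ := exists_eq_apply h h₁
    obtain ⟨b, hb, rfl⟩ := exists_eq_apply h h₂
    obtain ⟨c, hc, rfl⟩ := exists_eq_apply h h₃
    rw [dTwoForm_eq_neg_neutral_nijenhuis hE h _ ha hb hc, hτ a b ha hb, LinearMap.map_zero₂,
      neg_zero]
  · rintro ⟨hC, -, hK⟩ a b ha hb x
    refine eq_zero_of_neutral_eq_zero fun c => ?_
    obtain ⟨c, hc, rfl⟩ := exists_smoothSection_eq c
    rw [← neg_eq_zero, ← dTwoForm_eq_neg_neutral_nijenhuis hE h hC ha hb hc]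
    exact hK ..

end

end GenGeom

end

theorem proposition5p2
    {V : Type*} [NormedAddCommGroup V] [NormedSpace ℝ V] [FiniteDimensional ℝ V]
    {M : Type*} [TopologicalSpace M] [T2Space M] [ChartedSpace V M] [IsManifold 𝓘(ℝ, V) ∞ M]
    (G : GenGeom.GenRiemannianMetric V M) (E : GenGeom.Subbundle V M) (hE : E.IsIsotropic V) :
    ∃ Φ : GenGeom.MetricTwoNilpotent V G E ≃ GenGeom.CompatibleComplex V G E,
      (∀ (τ : GenGeom.MetricTwoNilpotent V G E) (x : M) (e : E.fiber x),
        ((Φ τ).1 x e : GenGeom.BigTangent V x) = τ.1 x (G.φ x e)) ∧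
      ∀ τ : GenGeom.MetricTwoNilpotent V G E,
        GenGeom.IsIntegrable V τ.1 ↔
          ∃ h : E.CourantClosed V, GenGeom.IsAlmostKahler V G E h (Φ τ).1 :=
  ⟨GenGeom.nilpotentEquivComplex G hE, fun _ _ _ => rfl,
    fun τ => GenGeom.isIntegrable_iff hE τ.2⟩
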